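/- Let $n\ge 2$. Let $W^{1,n}(\mathbb R^n,\mathbb R^n)$ be the inhomogeneous Sobolev space of all mappings $u\in L^n(\mathbb R^n,\mathbb R^n)$ whose weak partial derivatives $\partial_j u_i$, $1\le i,j\le n$, all belong to $L^n(\mathbb R^n)$. For $u\in W^{1,n}(\mathbb R^n,\mathbb R^n)$ let $Ju=\det(\partial_j u_i)_{i,j=1}^n\in L^1(\mathbb R^n)$ be its Jacobian determinant, regarded as the tempered distribution $\varphi\mapsto\int_{\mathbb R^n}\varphi\,Ju$. Fix any real-valued $\eta\in C_c^\infty(\mathbb R^n)$ with $\int_{\mathbb R^n}\eta\ne 0$, put $\eta_t(x)=t^{-n}\eta(x/t)$ for $t>0$, and let $$\mathcal H^1(\mathbb R^n)=\Big\{h\in\mathcal S'(\mathbb R^n)\ \text{real-valued}:\ \sup_{t>0}|h*\eta_t|\in L^1(\mathbb R^n)\Big\}$$ be the real-variable Hardy space. Then the Jacobian operator $J$ does not map $W^{1,n}(\mathbb R^n,\mathbb R^n)$ onto $\mathcal H^1(\mathbb R^n)$: there is $h\in\mathcal H^1(\mathbb R^n)$ such that $Ju\ne h$ for every $u\in W^{1,n}(\mathbb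 R^n,\mathbb R^n)$. -/

import Mathlib

open MeasureTheory SchwartzMap
open scoped ENNReal ContDiff

noncomputable section

/-- `ℝⁿ` with its Euclidean norm and Lebesgue measure. -/
abbrev Eucl (n : ℕ) : Type := EuclideanSpace ℝ (Fin n)

/-- Real tempered distributions on `ℝⁿ`: continuous real-linear functionals on the space of
real-valued Schwartz functions. -/
abbrev RealTempered (n : ℕ) : Type := 𝓢(Eucl n, ℝ) →L[ℝ] ℝ

/-- `D` is the weak derivative matrix of `u`, i.e. `D x i j` is the weak partial derivative
`∂ⱼ uᵢ (x)`: both functions are locally integrable, and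
`∫ uᵢ ∂ⱼφ = - ∫ Dᵢⱼ φ` for all real test functions `φ ∈ C_c^∞(ℝⁿ)`. -/
def IsWeakDerivative {n : ℕ} (u : Eucl n → Eucl n)
    (D : Eucl n → Matrix (Fin n) (Fin n) ℝ) : Prop :=
  ∀ i j : Fin n,
    LocallyIntegrable (fun x => u x i) volume ∧
    LocallyIntegrable (fun x => D x i j) volume ∧
    ∀ φ : Eucl n → ℝ, ContDiff ℝ ∞ φ → HasCompactSupport φ →
      ∫ x, u x i * fderiv ℝ φ x (EuclideanSpace.single j 1) = -∫ x, D x i j * φ x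

/-- The inhomogeneous Sobolev space `W^{1,n}(ℝⁿ, ℝⁿ)`. An element is given by (representatives of)
a mapping `u ∈ Lⁿ` and its weak derivative matrix `D u`, all of whose entries are in `Lⁿ`
(the weak derivative is determined by `u` up to null sets). -/
structure SobolevMap (n : ℕ) where
  /-- the mapping `u` -/
  toFun : Eucl n → Eucl n
  /-- its weak derivative matrix -/
  weakD : Eucl n → Matrix (Fin n) (Fin n) ℝ
  memLp_toFun : MemLp toFun (n : ℝ≥0∞) volume
  memLp_weakD : ∀ i j : Fin n, MemLp (fun x => weakD x i j) (n : ℝ≥0∞) volume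
  isWeakDerivative : IsWeakDerivative toFun weakD

/-- The tempered distribution `φ ↦ ∫ f φ` of an integrable function `f`. -/
def ofIntegrable {n : ℕ} (f : Eucl n → ℝ) (hf : Integrable f volume) : RealTempered n :=
  have hint : ∀ φ : 𝓢(Eucl n, ℝ), Integrable (fun x => f x * φ x) volume := fun φ =>
    hf.mul_bdd (c := SchwartzMap.seminorm ℝ 0 0 φ) φ.continuous.aestronglyMeasurable
      (Filter.Eventually.of_forall fun x => φ.norm_le_seminorm ℝ x)
  SchwartzMap.mkCLMtoNormedSpace (fun φ => ∫ x, f x * φ x)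
    (fun φ ψ => by
      simp only [add_apply, mul_add]
      exact integral_add (hint φ) (hint ψ))
    (fun a φ => by
      simp only [smul_apply, smul_eq_mul, RingHom.id_apply]
      rw [← integral_const_mul]
      congr 1
      ext x
      ring)
    ⟨{(0, 0)}, ∫ x, ‖f x‖, integral_nonneg fun _ => norm_nonneg _, fun φ => by
      rw [Finset.sup_singleton, SchwartzMap.schwartzSeminormFamily_apply,
        ← integral_mul_const]
      refine norm_integral_le_of_norm_le (hf.norm.mul_const _)
        (Filter.Eventually.of_forall fun x => ?_)
      rw [norm_mul]
      exact mul_le_mul_of_nonneg_left (φ.norm_le_seminorm ℝ x) (norm_nonneg _)⟩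

theorem ofIntegrable_apply {n : ℕ} (f : Eucl n → ℝ) (hf : Integrable f volume)
    (φ : 𝓢(Eucl n, ℝ)) : ofIntegrable f hf φ = ∫ x, f x * φ x := rfl

theorem SobolevMap.integrable_det {n : ℕ} (u : SobolevMap n) :
    Integrable (fun x => (u.weakD x).det) volume := by
  simp only [Matrix.det_apply']
  refine integrable_finsetSum _ fun σ _ => Integrable.const_mul ?_ _
  rcases Nat.eq_zero_or_pos n with rfl | hn
  · simp
  · have h := MemLp.prod' (μ := (volume : Measure (Eucl n))) (s := Finset.univ)
      (f := fun (i : Fin n) x => u.weakD x (σ i) i) (p := fun _ => (n : ℝ≥0∞))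
      (fun i _ => u.memLp_weakD (σ i) i)
    have hp : (∑ _i : Fin n, ((n : ℝ≥0∞))⁻¹)⁻¹ = 1 := by
      rw [Finset.sum_const, Finset.card_univ, Fintype.card_fin, nsmul_eq_mul,
        ENNReal.mul_inv_cancel (by exact_mod_cast hn.ne') (ENNReal.natCast_ne_top n), inv_one]
    rw [hp] at h
    exact memLp_one_iff_integrable.mp h

/-- The Jacobian operator `u ↦ J u = det (D u)`; the integrable function `J u` is regarded as a
tempered distribution. -/
def jacobian {n : ℕ} (u : SobolevMap n) : RealTempered n :=
  ofIntegrable (fun x => (u.weakD x).det) u.integrable_det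

/-- The dilate `η_t (x) = t⁻ⁿ η (x / t)`. -/
def dilate {n : ℕ} (η : Eucl n → ℝ) (t : ℝ) (x : Eucl n) : ℝ :=
  (t ^ n)⁻¹ * η (t⁻¹ • x)

theorem dilate_contDiff {n : ℕ} {η : Eucl n → ℝ} (hη : ContDiff ℝ ∞ η) (t : ℝ) (x : Eucl n) :
    ContDiff ℝ ∞ (fun y => dilate η t (x - y)) := by
  unfold dilate
  fun_prop

theorem dilate_hasCompactSupport {n : ℕ} {η : Eucl n → ℝ} (hη : HasCompactSupport η)
    {t : ℝ} (ht : 0 < t) (x : Eucl n) :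
    HasCompactSupport (fun y => dilate η t (x - y)) := by
  unfold dilate
  have h1 : HasCompactSupport fun z : Eucl n => η (t⁻¹ • z) :=
    hη.comp_smul (inv_ne_zero ht.ne')
  have h2 : HasCompactSupport fun y : Eucl n => η (t⁻¹ • (x - y)) :=
    h1.comp_homeomorph (Homeomorph.subLeft x)
  exact h2.mul_left

/-- The convolution `(h * η_t)(x) = ⟨h, η_t (x - ·)⟩` of a tempered distribution with the dilate
of a test function, for `t > 0`. -/
def convDilate {n : ℕ} (h : RealTempered n) {η : Eucl n → ℝ} (hs : ContDiff ℝ ∞ η)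
    (hc : HasCompactSupport η) {t : ℝ} (ht : 0 < t) (x : Eucl n) : ℝ :=
  h ((dilate_hasCompactSupport hc ht x).toSchwartzMap (dilate_contDiff hs t x))

/-- The real-variable Hardy space `ℋ¹(ℝⁿ)`: the tempered distributions `h` for which the maximal
function `sup_{t > 0} |h * η_t|` is in `L¹(ℝⁿ)`. (A supremum of continuous functions is
measurable, so this means that its integral is finite.) -/
def hardyH1 {n : ℕ} {η : Eucl n → ℝ} (hs : ContDiff ℝ ∞ η) (hc : HasCompactSupport η) :
    Set (RealTempered n) :=
  {h | ∫⁻ x, ⨆ (t : ℝ) (ht : 0 < t), ‖convDilate h hs hc ht x‖ₑ < ⊤}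

end

/-! The obstruction is at low frequencies. Because `u` itself, and not only its gradient, lies in
Lⁿ, the Jacobian has divergence form with integrable flux: `Ju` is the divergence of `u_{i₀}` times
a row of cofactors, and Hölder puts each product of one `u_{i₀}` with n - 1 derivatives in L¹. Hence
|∫ φ Ju| ≤ C(u) ‖∇φ‖_∞ for every test function φ (`SobolevMap.exists_abs_integral_det_mul_le`). The
divergence identity is proved for smooth maps, where cofactor rows are divergence free, and passes
to W^{1,n} by mollification.

No such bound holds for all of the Hardy space. The maximal function has an L¹ norm that does not
change when `a` is replaced by its dilate a_s, so h = ∑ 2⁻ᵏ a_{4ᵏ} belongs to the Hardy space once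
`a` is smooth, compactly supported and of mean zero (`ofIntegrable_dilateSum_mem_hardyH1`). Take for
`a` the odd function xᵢ χ(x), and test h against φ_m(x) = 4ᵐ a(4⁻ᵐ x). The gradients of the φ_m are
bounded uniformly in m, while the pairing is at least 2ᵐ ∫ a²
(`le_integral_dilateSum_coordBump_mul`). So h is not a Jacobian. -/

noncomputable section

/-! ### Mollification in Lᵖ -/

open Filter Topology in
/-- Translation is continuous in `Lᵖ` for finite `p`. -/
theorem tendsto_eLpNorm_translate_sub {n : ℕ} {p : ℝ≥0∞} (hp : 1 ≤ p) (hp' : p ≠ ⊤)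
    {f : Eucl n → ℝ} (hf : MemLp f p) :
    Tendsto (fun y => eLpNorm (fun x => f (y + x) - f x) p volume) (𝓝 0) (𝓝 0) := by
  have : Fact (1 ≤ p) := ⟨hp⟩
  have : Fact (p ≠ ⊤) := ⟨hp'⟩
  have hcont : Continuous fun y : Eucl n => (DomAddAct.mk y) +ᵥ hf.toLp f := by
    have h := DomAddAct.continuous_mk (M := Eucl n)
    exact h.vadd continuous_const
  have h0 := (hcont.tendsto 0)
  rw [tendsto_iff_edist_tendsto_0] at h0
  refine h0.congr fun y => ?_
  have hz : (DomAddAct.mk (0 : Eucl n)) +ᵥ hf.toLp f = hf.toLp f := by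
    rw [DomAddAct.mk_zero, zero_vadd]
  rw [hz, DomAddAct.mk_vadd_toLp, Lp.edist_toLp_toLp]
  rfl

open scoped Convolution in
/-- Minkowski's inequality for mollifiers: the mollification error is controlled by the
translation errors. -/
theorem eLpNorm_convolution_normed_sub_le {n : ℕ} {p : ℝ≥0∞} (hp : 1 ≤ p) (hp' : p ≠ ⊤)
    {f : Eucl n → ℝ} (hf : MemLp f p) (hfm : StronglyMeasurable f)
    (ρ : ContDiffBump (0 : Eucl n)) {C : ℝ≥0∞}
    (hC : ∀ y ∈ Metric.ball (0 : Eucl n) ρ.rOut,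
      eLpNorm (fun x => f (-y + x) - f x) p volume ≤ C) :
    eLpNorm (fun x => (ρ.normed volume ⋆[ContinuousLinearMap.lsmul ℝ ℝ, volume] f) x - f x) p volume ≤ C := by
  have hp0 : p ≠ 0 := (zero_lt_one.trans_le hp).ne'
  have hpr : 0 < p.toReal := ENNReal.toReal_pos hp0 hp'
  -- The kernel is a probability density, so monotonicity of Lᵖ norms in p over `ν`, followed by
  -- Tonelli, replaces the integral Minkowski inequality.
  set ν : Measure (Eucl n) := volume.withDensity fun y => ENNReal.ofReal (ρ.normed volume y) with hν
  have hρm : Measurable fun y => ENNReal.ofReal (ρ.normed volume y) :=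
    (ρ.continuous_normed.measurable).ennreal_ofReal
  have hν1 : ν Set.univ = 1 := by
    rw [hν, withDensity_apply _ MeasurableSet.univ, Measure.restrict_univ,
      ← ofReal_integral_eq_lintegral_ofReal ρ.integrable_normed
        (Filter.Eventually.of_forall ρ.nonneg_normed), ρ.integral_normed, ENNReal.ofReal_one]
  have : IsProbabilityMeasure ν := ⟨hν1⟩
  have hloc : LocallyIntegrable f volume := hf.locallyIntegrable hp
  have hmeas : Measurable fun z : Eucl n × Eucl n => f (-z.2 + z.1) - f z.1 :=
    (hfm.measurable.comp (by fun_prop)).sub (hfm.measurable.comp measurable_fst)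
  have hpt : ∀ x, ‖(ρ.normed volume ⋆[ContinuousLinearMap.lsmul ℝ ℝ, volume] f) x - f x‖ₑ ^ p.toReal ≤
      ∫⁻ y, ‖f (-y + x) - f x‖ₑ ^ p.toReal ∂ν := by
    intro x
    have hint : Integrable (fun y => ρ.normed volume y * f (-y + x)) := by
      have := (ρ.hasCompactSupport_normed (μ := volume)).convolutionExists_left
        (L := ContinuousLinearMap.lsmul ℝ ℝ) ρ.continuous_normed hloc x
      refine (this.integrable).congr (Filter.Eventually.of_forall fun y => ?_)
      simp [neg_add_eq_sub]
    have h1 : (ρ.normed volume ⋆[ContinuousLinearMap.lsmul ℝ ℝ, volume] f) x - f x =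
        ∫ y, ρ.normed volume y * (f (-y + x) - f x) := by
      simp_rw [mul_sub]
      rw [integral_sub hint (ρ.integrable_normed.mul_const _), integral_mul_const,
        ρ.integral_normed, one_mul, convolution_lsmul]
      simp [neg_add_eq_sub]
    have h2 : ‖(ρ.normed volume ⋆[ContinuousLinearMap.lsmul ℝ ℝ, volume] f) x - f x‖ₑ ≤
        eLpNorm (fun y => f (-y + x) - f x) 1 ν := by
      rw [h1, eLpNorm_one_eq_lintegral_enorm, hν, lintegral_withDensity_eq_lintegral_mul _ hρm]
      · refine (enorm_integral_le_lintegral_enorm _).trans (le_of_eq (lintegral_congr fun y => ?_))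
        rw [enorm_mul, Real.enorm_of_nonneg (ρ.nonneg_normed y)]
        rfl
      · exact (hmeas.comp (measurable_const.prodMk measurable_id)).enorm
    have h3 := h2.trans (eLpNorm_le_eLpNorm_of_exponent_le hp
      (f := fun y => f (-y + x) - f x) (μ := ν)
      (hmeas.comp (measurable_const.prodMk measurable_id)).aestronglyMeasurable)
    rw [eLpNorm_eq_lintegral_rpow_enorm_toReal hp0 hp'] at h3
    calc _ ≤ ((∫⁻ y, ‖f (-y + x) - f x‖ₑ ^ p.toReal ∂ν) ^ (1 / p.toReal)) ^ p.toReal :=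
          ENNReal.rpow_le_rpow h3 hpr.le
      _ = _ := by rw [← ENNReal.rpow_mul, one_div, inv_mul_cancel₀ hpr.ne', ENNReal.rpow_one]
  rw [eLpNorm_eq_lintegral_rpow_enorm_toReal hp0 hp']
  have hmain : ∫⁻ x, ‖(ρ.normed volume ⋆[ContinuousLinearMap.lsmul ℝ ℝ, volume] f) x - f x‖ₑ ^ p.toReal ≤
      C ^ p.toReal := by
    calc _ ≤ ∫⁻ x, ∫⁻ y, ‖f (-y + x) - f x‖ₑ ^ p.toReal ∂ν := lintegral_mono hpt
      _ = ∫⁻ y, ∫⁻ x, ‖f (-y + x) - f x‖ₑ ^ p.toReal ∂volume ∂ν :=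
          lintegral_lintegral_swap ((hmeas.enorm.pow_const _).aemeasurable)
      _ ≤ ∫⁻ y, C ^ p.toReal ∂ν := by
          refine lintegral_mono_ae ?_
          have hae : ∀ᵐ y ∂ν, y ∈ Metric.ball (0 : Eucl n) ρ.rOut := by
            rw [hν, ae_withDensity_iff hρm]
            refine Filter.Eventually.of_forall fun y hy => ?_
            rw [← ρ.support_normed_eq (μ := volume)]
            intro h0
            exact hy (by simp [h0])
          filter_upwards [hae] with y hy
          have h := hC y hy
          rw [eLpNorm_eq_lintegral_rpow_enorm_toReal hp0 hp', one_div] at h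
          exact (ENNReal.rpow_inv_le_iff hpr).mp h
      _ = C ^ p.toReal := by rw [lintegral_const, hν1, mul_one]
  rw [one_div, ENNReal.rpow_inv_le_iff hpr]
  exact hmain

open Filter Topology in
open scoped Convolution in
/-- Mollifications converge in `Lᵖ` for finite `p`. -/
theorem tendsto_eLpNorm_convolution_normed_sub {n : ℕ} {p : ℝ≥0∞} (hp : 1 ≤ p) (hp' : p ≠ ⊤)
    {f : Eucl n → ℝ} (hf : MemLp f p) {ρ : ℕ → ContDiffBump (0 : Eucl n)}
    (hρ : Tendsto (fun k => (ρ k).rOut) atTop (𝓝 0)) :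
    Tendsto (fun k => eLpNorm ((((ρ k).normed volume ⋆[ContinuousLinearMap.lsmul ℝ ℝ, volume] f)) - f) p
      volume) atTop (𝓝 0) := by
  -- A genuinely measurable representative makes the translation differences jointly measurable, as
  -- Tonelli requires.
  obtain ⟨g, hgm, hfg⟩ := hf.aestronglyMeasurable
  have hg : MemLp g p := hf.ae_eq hfg
  have hconv : ∀ k, eLpNorm ((((ρ k).normed volume ⋆[ContinuousLinearMap.lsmul ℝ ℝ, volume] f)) - f) p volume =
      eLpNorm (fun x => ((ρ k).normed volume ⋆[ContinuousLinearMap.lsmul ℝ ℝ, volume] g) x - g x) p volume := by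
    intro k
    refine eLpNorm_congr_ae ?_
    have : ((ρ k).normed volume ⋆[ContinuousLinearMap.lsmul ℝ ℝ, volume] f) =
        ((ρ k).normed volume ⋆[ContinuousLinearMap.lsmul ℝ ℝ, volume] g) :=
      convolution_congr (L := ContinuousLinearMap.lsmul ℝ ℝ) (ae_eq_refl _) hfg
    filter_upwards [hfg] with x hx
    rw [Pi.sub_apply, this, hx]
  simp_rw [hconv]
  rw [ENNReal.tendsto_nhds_zero]
  intro ε hε
  have h1 := ENNReal.tendsto_nhds_zero.mp (tendsto_eLpNorm_translate_sub hp hp' hg) ε hε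
  obtain ⟨δ, hδ, h2⟩ := Metric.eventually_nhds_iff_ball.mp h1
  filter_upwards [hρ.eventually (gt_mem_nhds hδ)] with k hk
  refine eLpNorm_convolution_normed_sub_le hp hp' hg hgm _ fun y hy => h2 (-y) ?_
  simp only [mem_ball_zero_iff, norm_neg] at hy ⊢
  exact hy.trans hk

/-! ### Limits of products under Hölder's inequality -/

open Filter Topology in
/-- Products of `Lᵖ`-convergent sequences converge. -/
theorem tendsto_eLpNorm_prod_sub {α ι : Type*} [MeasurableSpace α] {μ : Measure α}
    {p : ι → ℝ≥0∞} (s : Finset ι) (hs : ∑ i ∈ s, (p i)⁻¹ ≤ 1) {F : ℕ → ι → α → ℝ} {f : ι → α → ℝ}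
    (hF : ∀ k, ∀ i ∈ s, AEStronglyMeasurable (F k i) μ) (hf : ∀ i ∈ s, MemLp (f i) (p i) μ)
    (h : ∀ i ∈ s, Tendsto (fun k => eLpNorm (F k i - f i) (p i) μ) atTop (𝓝 0)) :
    Tendsto (fun k => eLpNorm (∏ i ∈ s, F k i - ∏ i ∈ s, f i) (∑ i ∈ s, (p i)⁻¹)⁻¹ μ)
      atTop (𝓝 0) := by
  induction s using Finset.cons_induction with
  | empty => simp
  | cons a s ha ih =>
    have hs' : ∑ i ∈ s, (p i)⁻¹ ≤ 1 := by
      rw [Finset.sum_cons] at hs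
      exact le_add_self.trans hs
    have ih := ih hs' (fun k i hi => hF k i (Finset.mem_cons_of_mem hi))
      (fun i hi => hf i (Finset.mem_cons_of_mem hi)) (fun i hi => h i (Finset.mem_cons_of_mem hi))
    have ha' := h a (Finset.mem_cons_self a s)
    have hfa := hf a (Finset.mem_cons_self a s)
    have hP := MemLp.prod (f := f) (p := p) (s := s) fun i hi =>
      hf i (Finset.mem_cons.2 (Or.inr hi))
    set q := (∑ i ∈ s, (p i)⁻¹)⁻¹ with hq
    set r := (∑ i ∈ Finset.cons a s ha, (p i)⁻¹)⁻¹ with hr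
    have hr1 : 1 ≤ r := ENNReal.one_le_inv.mpr hs
    have : ENNReal.HolderTriple (p a) q r := ⟨by simp [hq, hr]⟩
    clear_value q r
    set P := ∏ i ∈ s, f i
    have hQm : ∀ k, AEStronglyMeasurable (∏ i ∈ s, F k i) μ := fun k =>
      Finset.aestronglyMeasurable_prod _ fun i hi => hF k i (Finset.mem_cons_of_mem hi)
    have hdm : ∀ k, AEStronglyMeasurable (F k a - f a) μ := fun k =>
      (hF k a (Finset.mem_cons_self a s)).sub hfa.aestronglyMeasurable
    have hem : ∀ k, AEStronglyMeasurable (∏ i ∈ s, F k i - P) μ := fun k =>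
      (hQm k).sub hP.aestronglyMeasurable
    have hmul : ∀ u v : α → ℝ, AEStronglyMeasurable u μ → AEStronglyMeasurable v μ →
        eLpNorm (u * v) r μ ≤ eLpNorm u (p a) μ * eLpNorm v q μ := fun u v hu hv =>
      eLpNorm_smul_le_mul_eLpNorm (p := p a) (q := q) (r := r) (f := v) (φ := u) hv hu
    refine tendsto_of_tendsto_of_tendsto_of_le_of_le
      (g := fun _ => 0)
      (h := fun k => eLpNorm (F k a - f a) (p a) μ * eLpNorm (∏ i ∈ s, F k i - P) q μ +
        eLpNorm (F k a - f a) (p a) μ * eLpNorm P q μ +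
        eLpNorm (f a) (p a) μ * eLpNorm (∏ i ∈ s, F k i - P) q μ) tendsto_const_nhds ?_
      (fun _ => zero_le) (fun k => ?_)
    · have h1 := ENNReal.Tendsto.mul ha' (Or.inr ENNReal.zero_ne_top) ih (Or.inr ENNReal.zero_ne_top)
      have h2 := ENNReal.Tendsto.mul_const ha' (Or.inr hP.eLpNorm_ne_top)
      have h3 := ENNReal.Tendsto.const_mul ih (Or.inr hfa.eLpNorm_ne_top)
      simpa using (h1.add h2).add h3
    · simp only [Finset.prod_cons]
      -- Expanding around the limits leaves in every term a factor tending to zero; no uniform bound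
      -- on the `F k` is needed.
      have hid : F k a * ∏ i ∈ s, F k i - f a * P =
          (F k a - f a) * (∏ i ∈ s, F k i - P) + (F k a - f a) * P +
            f a * (∏ i ∈ s, F k i - P) := by ring
      rw [hid]
      refine (eLpNorm_add_le (((hdm k).mul (hem k)).add ((hdm k).mul hP.aestronglyMeasurable))
        (hfa.aestronglyMeasurable.mul (hem k)) hr1).trans ?_
      refine add_le_add ((eLpNorm_add_le ((hdm k).mul (hem k))
        ((hdm k).mul hP.aestronglyMeasurable) hr1).trans ?_) (hmul _ _ hfa.aestronglyMeasurable (hem k))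
      exact add_le_add (hmul _ _ (hdm k) (hem k)) (hmul _ _ (hdm k) hP.aestronglyMeasurable)

open Filter Topology in
/-- The product of `n` sequences converging in `Lⁿ` converges weakly in `L¹`. -/
theorem tendsto_integral_mul_prod {n : ℕ} (hn : n ≠ 0) {F : ℕ → Fin n → Eucl n → ℝ}
    {f : Fin n → Eucl n → ℝ} (hF : ∀ k i, AEStronglyMeasurable (F k i) volume)
    (hf : ∀ i, MemLp (f i) n)
    (h : ∀ i, Tendsto (fun k => eLpNorm (F k i - f i) n volume) atTop (𝓝 0)) {φ : Eucl n → ℝ}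
    (hφ : Continuous φ) {B : ℝ} (hB : ∀ x, ‖φ x‖ ≤ B) :
    Tendsto (fun k => ∫ x, φ x * ∏ i, F k i x) atTop (𝓝 (∫ x, φ x * ∏ i, f i x)) ∧
      Integrable (fun x => ∏ i, f i x) := by
  have hp : (∑ _i : Fin n, ((n : ℝ≥0∞))⁻¹) = 1 := by
    rw [Finset.sum_const, Finset.card_univ, Fintype.card_fin, nsmul_eq_mul,
      ENNReal.mul_inv_cancel (by exact_mod_cast hn) (ENNReal.natCast_ne_top n)]
  have hint : ∀ g : Fin n → Eucl n → ℝ, (∀ i, MemLp (g i) n) →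
      Integrable (fun x => ∏ i, g i x) := by
    intro g hg
    have := MemLp.prod' (s := Finset.univ) (p := fun _ : Fin n => (n : ℝ≥0∞)) fun i _ => hg i
    rw [hp, inv_one] at this
    exact memLp_one_iff_integrable.mp this
  refine ⟨?_, hint f hf⟩
  have hlim := tendsto_eLpNorm_prod_sub (p := fun _ : Fin n => (n : ℝ≥0∞)) Finset.univ hp.le
    (fun k i _ => hF k i) (fun i _ => hf i) (fun i _ => h i)
  rw [hp, inv_one] at hlim
  have hbdd : ∀ g : Eucl n → ℝ, Integrable g → Integrable fun x => φ x * g x := fun g hg =>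
    hg.bdd_mul hφ.aestronglyMeasurable (Eventually.of_forall hB)
  have hmem : ∀ᶠ k in atTop, ∀ i, MemLp (F k i) n := by
    rw [eventually_all]
    intro i
    filter_upwards [(h i).eventually (gt_mem_nhds ENNReal.zero_lt_top)] with k hk
    have h1 : MemLp (F k i - f i) n := ⟨(hF k i).sub (hf i).aestronglyMeasurable, hk⟩
    simpa using h1.add (hf i)
  refine tendsto_integral_of_L1' _ (hbdd _ (hint f hf)).aestronglyMeasurable
    (hmem.mono fun k hk => hbdd _ (hint _ hk)) ?_
  have hle : ∀ k, eLpNorm ((fun x => φ x * ∏ i, F k i x) - fun x => φ x * ∏ i, f i x) 1 volume ≤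
      ENNReal.ofReal B * eLpNorm (∏ i, F k i - ∏ i, f i) 1 volume := by
    intro k
    refine eLpNorm_le_mul_eLpNorm_of_ae_le_mul (Eventually.of_forall fun x => ?_) 1
    simp only [Pi.sub_apply, Finset.prod_apply, ← mul_sub, norm_mul]
    exact mul_le_mul_of_nonneg_right (hB x) (norm_nonneg _)
  refine tendsto_of_tendsto_of_tendsto_of_le_of_le tendsto_const_nhds ?_ (fun _ => zero_le) hle
  simpa using ENNReal.Tendsto.const_mul hlim (Or.inr ENNReal.ofReal_ne_top)

/-! ### Null Lagrangian identities for smooth maps -/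

/-- The partial derivative `∂ⱼ f (x)`. -/
def partialDeriv {n : ℕ} (j : Fin n) (f : Eucl n → ℝ) (x : Eucl n) : ℝ :=
  fderiv ℝ f x (EuclideanSpace.single j 1)

theorem contDiff_partialDeriv {n : ℕ} (j : Fin n) {f : Eucl n → ℝ} (hf : ContDiff ℝ ∞ f) :
    ContDiff ℝ ∞ (partialDeriv j f) :=
  (hf.fderiv_right (m := ∞) (by simp)).clm_apply contDiff_const

theorem partialDeriv_comm {n : ℕ} (j k : Fin n) {f : Eucl n → ℝ} (hf : ContDiff ℝ ∞ f)
    (x : Eucl n) :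
    partialDeriv j (partialDeriv k f) x = partialDeriv k (partialDeriv j f) x := by
  have hd : DifferentiableAt ℝ (fderiv ℝ f) x :=
    ((hf.fderiv_right (m := ∞) (by simp)).differentiable (by simp)) x
  have key : ∀ a b : Fin n, partialDeriv a (partialDeriv b f) x =
      fderiv ℝ (fderiv ℝ f) x (EuclideanSpace.single a 1) (EuclideanSpace.single b 1) := by
    intro a b
    unfold partialDeriv
    rw [fderiv_clm_apply hd (differentiableAt_const _)]
    simp
  rw [key, key]
  exact (hf.contDiffAt.isSymmSndFDerivAt (by simpa using WithTop.coe_le_coe.2 (le_top : (2 : ℕ∞) ≤ ⊤))) _ _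

theorem partialDeriv_mul {n : ℕ} (j : Fin n) {f g : Eucl n → ℝ} (hf : ContDiff ℝ ∞ f)
    (hg : ContDiff ℝ ∞ g) (x : Eucl n) :
    partialDeriv j (fun y => f y * g y) x = f x * partialDeriv j g x + g x * partialDeriv j f x := by
  unfold partialDeriv
  rw [fderiv_fun_mul (hf.differentiable (by simp) x) (hg.differentiable (by simp) x)]
  simp

theorem partialDeriv_finsetProd {n : ℕ} {ι : Type*} [DecidableEq ι] (j : Fin n) (s : Finset ι)
    {f : ι → Eucl n → ℝ} (hf : ∀ i, ContDiff ℝ ∞ (f i)) (x : Eucl n) :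
    partialDeriv j (fun y => ∏ i ∈ s, f i y) x =
      ∑ k ∈ s, (∏ i ∈ s.erase k, f i x) * partialDeriv j (f k) x := by
  unfold partialDeriv
  have h := fderiv_finsetProd (𝕜 := ℝ) (u := s) (g := f) (x := x) fun i _ =>
    (hf i).differentiable (by simp) x
  simp [h]

open Equiv.Perm in
/-- The rows of the cofactor matrix of a smooth map are divergence free. -/
theorem sum_sign_mul_partialDeriv_prod_eq_zero {n : ℕ} (i₀ : Fin n) {v : Fin n → Eucl n → ℝ}
    (hv : ∀ i, ContDiff ℝ ∞ (v i)) (x : Eucl n) :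
    ∑ σ : Equiv.Perm (Fin n), ((sign σ : ℤ) : ℝ) * partialDeriv (σ i₀)
      (fun y => ∏ i ∈ Finset.univ.erase i₀, partialDeriv (σ i) (v i) y) x = 0 := by
  simp_rw [fun σ : Equiv.Perm (Fin n) => partialDeriv_finsetProd (σ i₀) (Finset.univ.erase i₀)
    (f := fun i => partialDeriv (σ i) (v i)) (fun i => contDiff_partialDeriv (σ i) (hv i)) x,
    Finset.mul_sum]
  rw [Finset.sum_comm]
  refine Finset.sum_eq_zero fun k hk => ?_
  have hk : k ≠ i₀ := Finset.ne_of_mem_erase hk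
  refine self_eq_neg.mp ?_
  rw [← Finset.sum_neg_distrib]
  -- Composing σ with the transposition of `i₀` and `k` flips the sign and exchanges the two
  -- derivatives falling on `v k`. These commute, so the sum equals its own negative.
  conv_lhs => rw [← Equiv.sum_comp (Equiv.mulRight (Equiv.swap i₀ k))]
  refine Finset.sum_congr rfl fun σ _ => ?_
  have hprod : ∏ i ∈ (Finset.univ.erase i₀).erase k,
      partialDeriv ((σ * Equiv.swap i₀ k) i) (v i) x =
      ∏ i ∈ (Finset.univ.erase i₀).erase k, partialDeriv (σ i) (v i) x := by
    refine Finset.prod_congr rfl fun i hi => ?_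
    simp only [Finset.mem_erase] at hi
    rw [mul_apply, Equiv.swap_apply_of_ne_of_ne hi.2.1 hi.1]
  simp only [Equiv.coe_mulRight]
  rw [hprod]
  simp only [Equiv.Perm.sign_mul, sign_swap hk.symm, mul_apply,
    Equiv.swap_apply_left, Equiv.swap_apply_right]
  rw [partialDeriv_comm _ _ (hv k)]
  simp

theorem hasCompactSupport_partialDeriv {n : ℕ} (j : Fin n) {f : Eucl n → ℝ}
    (hf : HasCompactSupport f) : HasCompactSupport (partialDeriv j f) :=
  hf.fderiv_apply ℝ _

open Equiv.Perm in
/-- The Jacobian determinant is a null Lagrangian. -/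
theorem sum_sign_mul_integral_prod_partialDeriv_eq_zero {n : ℕ} (i₀ : Fin n)
    {v : Fin n → Eucl n → ℝ} (hv : ∀ i, ContDiff ℝ ∞ (v i)) (hc : HasCompactSupport (v i₀)) :
    ∑ σ : Equiv.Perm (Fin n), ((sign σ : ℤ) : ℝ) * ∫ x, ∏ i, partialDeriv (σ i) (v i) x = 0 := by
  set P : Equiv.Perm (Fin n) → Eucl n → ℝ := fun σ y =>
    ∏ i ∈ Finset.univ.erase i₀, partialDeriv (σ i) (v i) y with hP
  have hPs : ∀ σ, ContDiff ℝ ∞ (P σ) := fun σ =>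
    contDiff_prod fun i _ => contDiff_partialDeriv (σ i) (hv i)
  have hint : ∀ σ, Integrable (fun x => partialDeriv (σ i₀) (P σ) x * v i₀ x) := fun σ =>
    ((contDiff_partialDeriv _ (hPs σ)).continuous.mul (hv i₀).continuous).integrable_of_hasCompactSupport
      hc.mul_left
  have hparts : ∀ σ : Equiv.Perm (Fin n), ∫ x, ∏ i, partialDeriv (σ i) (v i) x =
      -∫ x, partialDeriv (σ i₀) (P σ) x * v i₀ x := by
    intro σ
    have h := integral_mul_fderiv_eq_neg_fderiv_mul_of_integrable (μ := (volume : Measure (Eucl n)))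
      (f := P σ) (g := v i₀) (v := EuclideanSpace.single (σ i₀) (1 : ℝ)) (hint σ)
      (((hPs σ).continuous.mul
        (contDiff_partialDeriv (σ i₀) (hv i₀)).continuous).integrable_of_hasCompactSupport
          (hasCompactSupport_partialDeriv _ hc).mul_left)
      (((hPs σ).continuous.mul (hv i₀).continuous).integrable_of_hasCompactSupport hc.mul_left)
      (fun x _ => (hPs σ).differentiable (by simp) x)
      (fun x _ => (hv i₀).differentiable (by simp) x)
    refine Eq.trans (integral_congr_ae (Filter.Eventually.of_forall fun x => ?_)) h
    exact (Finset.prod_erase_mul Finset.univ (fun i => partialDeriv (σ i) (v i) x)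
      (Finset.mem_univ i₀)).symm
  simp_rw [hparts, mul_neg, Finset.sum_neg_distrib, ← integral_const_mul]
  rw [← integral_finsetSum _ fun σ _ => (hint σ).const_mul _]
  simp_rw [← mul_assoc, ← Finset.sum_mul]
  simp [hP, sum_sign_mul_partialDeriv_prod_eq_zero i₀ hv]

/-- Moving one derivative of the Jacobian of a smooth map onto the test function. -/
theorem sum_sign_mul_integral_prod_partialDeriv {n : ℕ} (i₀ : Fin n)
    {v : Fin n → Eucl n → ℝ} (hv : ∀ i, ContDiff ℝ ∞ (v i)) {φ : Eucl n → ℝ}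
    (hφ : ContDiff ℝ ∞ φ) (hc : HasCompactSupport φ) :
    ∑ σ : Equiv.Perm (Fin n), ((Equiv.Perm.sign σ : ℤ) : ℝ) *
        ∫ x, φ x * ∏ i, partialDeriv (σ i) (v i) x =
      -∑ σ : Equiv.Perm (Fin n), ((Equiv.Perm.sign σ : ℤ) : ℝ) *
        ∫ x, partialDeriv (σ i₀) φ x *
          ∏ i, Function.update (fun i => partialDeriv (σ i) (v i)) i₀ (v i₀) i x := by
  -- The null Lagrangian is applied to the map whose `i₀`-th component is multiplied by φ; the
  -- product rule then splits the vanishing integral into the two sides.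
  have h := sum_sign_mul_integral_prod_partialDeriv_eq_zero i₀
    (v := Function.update v i₀ (fun x => v i₀ x * φ x)) (fun i => by
      by_cases hi : i = i₀
      · subst hi; simpa using (hv i).mul hφ
      · simpa [hi] using hv i) (by rw [Function.update_self]; exact hc.mul_left)
  rw [← sub_eq_zero, sub_neg_eq_add, ← Finset.sum_add_distrib, ← h]
  refine Finset.sum_congr rfl fun σ _ => ?_
  rw [← mul_add, ← integral_add]
  · congr 2
    ext x
    rw [← Finset.mul_prod_erase _ _ (Finset.mem_univ i₀),
      ← Finset.mul_prod_erase _ _ (Finset.mem_univ i₀),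
      ← Finset.mul_prod_erase _ _ (Finset.mem_univ i₀)]
    have h1 : ∏ i ∈ Finset.univ.erase i₀,
        Function.update (fun i => partialDeriv (σ i) (v i)) i₀ (v i₀) i x =
        ∏ i ∈ Finset.univ.erase i₀, partialDeriv (σ i) (v i) x :=
      Finset.prod_congr rfl fun i hi => by rw [Function.update_of_ne (Finset.ne_of_mem_erase hi)]
    have h2 : ∏ i ∈ Finset.univ.erase i₀,
        partialDeriv (σ i) (Function.update v i₀ (fun x => v i₀ x * φ x) i) x =
        ∏ i ∈ Finset.univ.erase i₀, partialDeriv (σ i) (v i) x :=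
      Finset.prod_congr rfl fun i hi => by rw [Function.update_of_ne (Finset.ne_of_mem_erase hi)]
    rw [h1, h2, Function.update_self, Function.update_self, partialDeriv_mul _ (hv i₀) hφ]
    ring
  · refine Continuous.integrable_of_hasCompactSupport (hφ.continuous.mul
      (continuous_finsetProd _ fun i _ => (contDiff_partialDeriv _ (hv i)).continuous)) hc.mul_right
  · refine Continuous.integrable_of_hasCompactSupport
      ((contDiff_partialDeriv _ hφ).continuous.mul (continuous_finsetProd _ fun i _ => ?_))
      (hasCompactSupport_partialDeriv _ hc).mul_right
    by_cases hi : i = i₀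
    · subst hi; simpa using (hv i).continuous
    · simpa [hi] using (contDiff_partialDeriv _ (hv i)).continuous

/-! ### Mollification and weak derivatives -/

/-- The mollification `ρ * f`. -/
def mollify {n : ℕ} (ρ : ContDiffBump (0 : Eucl n)) (f : Eucl n → ℝ) : Eucl n → ℝ :=
  convolution (ρ.normed volume) f (ContinuousLinearMap.lsmul ℝ ℝ) volume

theorem mollify_apply {n : ℕ} (ρ : ContDiffBump (0 : Eucl n)) (f : Eucl n → ℝ) (x : Eucl n) :
    mollify ρ f x = ∫ y, f y * ρ.normed volume (x - y) := by
  rw [mollify, convolution_lsmul_swap]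
  simp [mul_comm]

theorem contDiff_mollify {n : ℕ} (ρ : ContDiffBump (0 : Eucl n)) {f : Eucl n → ℝ}
    (hf : LocallyIntegrable f volume) : ContDiff ℝ ∞ (mollify ρ f) :=
  ρ.hasCompactSupport_normed.contDiff_convolution_left _ ρ.contDiff_normed hf

/-- The derivative falls on the kernel, and y ↦ ρ(x - y) is an admissible test function in the
definition of the weak derivative; the sign from reflecting the kernel cancels the one from
integrating by parts. -/
theorem partialDeriv_mollify {n : ℕ} (ρ : ContDiffBump (0 : Eucl n)) {u : Eucl n → Eucl n}
    {D : Eucl n → Matrix (Fin n) (Fin n) ℝ} (h : IsWeakDerivative u D) (i j : Fin n) :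
    partialDeriv j (mollify ρ fun x => u x i) = mollify ρ fun x => D x i j := by
  obtain ⟨hu, -, hw⟩ := h i j
  ext x
  have hρ : ContDiff ℝ ∞ (ρ.normed volume) := ρ.contDiff_normed
  have hψ : ContDiff ℝ ∞ fun y => ρ.normed volume (x - y) := by fun_prop
  have hψc : HasCompactSupport fun y => ρ.normed volume (x - y) :=
    ρ.hasCompactSupport_normed.comp_homeomorph (Homeomorph.subLeft x)
  have hder : ∀ y, fderiv ℝ (fun y => ρ.normed volume (x - y)) y (EuclideanSpace.single j 1) =
      -fderiv ℝ (ρ.normed volume) (x - y) (EuclideanSpace.single j 1) := by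
    intro y
    have h1 := ((hρ.differentiable (by simp) (x - y)).hasFDerivAt).comp y
      ((hasFDerivAt_id y).const_sub x)
    have h2 : fderiv ℝ (fun y => ρ.normed volume (x - y)) y = _ := h1.fderiv
    rw [h2]
    simp
  have h1 := hw _ hψ hψc
  simp_rw [hder, mul_neg, integral_neg, neg_inj] at h1
  rw [mollify_apply, ← h1, partialDeriv, mollify, ← MeasureTheory.convolution_flip,
    (ρ.hasCompactSupport_normed.hasFDerivAt_convolution_right
      (ContinuousLinearMap.lsmul ℝ ℝ).flip hu (hρ.of_le (by simp)) x).fderiv,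
    convolution_precompR_apply _ hu (ρ.hasCompactSupport_normed.fderiv ℝ)
      (hρ.continuous_fderiv (by simp)), convolution_def]
  simp [mul_comm]

/-! ### The Jacobian in divergence form -/

namespace SobolevMap

variable {n : ℕ} (u : SobolevMap n)

theorem memLp_apply (i : Fin n) : MemLp (fun x => u.toFun x i) n volume :=
  (EuclideanSpace.proj (𝕜 := ℝ) i).comp_memLp' u.memLp_toFun

/-- The entries `u_{i₀}` (in row `i₀`) and `∂_{σ i} u_i` (in the other rows). -/
def parts (i₀ : Fin n) (σ : Equiv.Perm (Fin n)) : Fin n → Eucl n → ℝ :=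
  Function.update (fun i x => u.weakD x i (σ i)) i₀ fun x => u.toFun x i₀

theorem memLp_parts (i₀ : Fin n) (σ : Equiv.Perm (Fin n)) (i : Fin n) :
    MemLp (u.parts i₀ σ i) n volume := by
  by_cases hi : i = i₀
  · subst hi; simpa [parts] using u.memLp_apply i
  · simpa [parts, hi] using u.memLp_weakD i (σ i)

open Filter Topology in
/-- The distributional Jacobian of a Sobolev map: one derivative is moved onto the test
function. -/
theorem integral_det_mul (hn : n ≠ 0) (i₀ : Fin n) {φ : Eucl n → ℝ} (hφ : ContDiff ℝ ∞ φ)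
    (hc : HasCompactSupport φ) :
    ∫ x, (u.weakD x).det * φ x = -∑ σ : Equiv.Perm (Fin n), ((Equiv.Perm.sign σ : ℤ) : ℝ) *
      ∫ x, partialDeriv (σ i₀) φ x * ∏ i, u.parts i₀ σ i x := by
  let ρ : ℕ → ContDiffBump (0 : Eucl n) := fun k =>
    ⟨1 / (k + 1) / 2, 1 / (k + 1), by positivity, half_lt_self (by positivity)⟩
  have hρ : Tendsto (fun k => (ρ k).rOut) atTop (𝓝 0) := tendsto_one_div_add_atTop_nhds_zero_nat
  have hn1 : (1 : ℝ≥0∞) ≤ n := by exact_mod_cast Nat.one_le_iff_ne_zero.mpr hn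
  have hlim : ∀ f : Eucl n → ℝ, MemLp f n →
      Tendsto (fun k => eLpNorm (mollify (ρ k) f - f) n volume) atTop (𝓝 0) := fun f hf =>
    tendsto_eLpNorm_convolution_normed_sub hn1 (ENNReal.natCast_ne_top n) hf hρ
  have hmeas : ∀ f : Eucl n → ℝ, MemLp f n → ∀ k,
      AEStronglyMeasurable (mollify (ρ k) f) volume := fun f hf k =>
    (contDiff_mollify _ (hf.locallyIntegrable hn1)).continuous.aestronglyMeasurable
  have hlimprod : ∀ (f : Fin n → Eucl n → ℝ) (_ : ∀ i, MemLp (f i) n) (ψ : Eucl n → ℝ)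
      (_ : Continuous ψ) (_ : HasCompactSupport ψ),
      Tendsto (fun k => ∫ x, ψ x * ∏ i, mollify (ρ k) (f i) x) atTop
        (𝓝 (∫ x, ψ x * ∏ i, f i x)) := by
    intro f hf ψ hψ hψc
    obtain ⟨B, hB⟩ := hψ.bounded_above_of_compact_support hψc
    exact (tendsto_integral_mul_prod hn (fun k i => hmeas _ (hf i) k) hf
      (fun i => hlim _ (hf i)) hψ hB).1
  have hsmooth : ∀ k,
      ∑ σ : Equiv.Perm (Fin n), ((Equiv.Perm.sign σ : ℤ) : ℝ) *
          ∫ x, φ x * ∏ i, mollify (ρ k) (fun x => u.weakD x i (σ i)) x =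
        -∑ σ : Equiv.Perm (Fin n), ((Equiv.Perm.sign σ : ℤ) : ℝ) *
          ∫ x, partialDeriv (σ i₀) φ x * ∏ i, mollify (ρ k) (u.parts i₀ σ i) x := by
    intro k
    have h := sum_sign_mul_integral_prod_partialDeriv i₀
      (v := fun i => mollify (ρ k) fun x => u.toFun x i)
      (fun i => contDiff_mollify _ (u.isWeakDerivative i i).1) hφ hc
    simp only [partialDeriv_mollify (ρ k) u.isWeakDerivative] at h
    have hparts : ∀ σ i, mollify (ρ k) (u.parts i₀ σ i) =
        Function.update (fun i => mollify (ρ k) fun x => u.weakD x i (σ i)) i₀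
          (mollify (ρ k) fun x => u.toFun x i₀) i := by
      intro σ i
      by_cases hi : i = i₀
      · subst hi; simp [parts]
      · simp [parts, hi]
    simpa only [hparts] using h
  have hleft := tendsto_finsetSum Finset.univ fun (σ : Equiv.Perm (Fin n)) _ =>
    (hlimprod (fun i x => u.weakD x i (σ i)) (fun i => u.memLp_weakD i (σ i)) φ hφ.continuous
      hc).const_mul (((Equiv.Perm.sign σ : ℤ) : ℝ))
  have hright := (tendsto_finsetSum Finset.univ fun (σ : Equiv.Perm (Fin n)) _ =>
    (hlimprod (u.parts i₀ σ) (u.memLp_parts i₀ σ) (partialDeriv (σ i₀) φ)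
      (contDiff_partialDeriv _ hφ).continuous
      (hasCompactSupport_partialDeriv _ hc)).const_mul (((Equiv.Perm.sign σ : ℤ) : ℝ))).neg
  rw [← tendsto_nhds_unique (hleft.congr hsmooth) hright]
  obtain ⟨B, hB⟩ := hφ.continuous.bounded_above_of_compact_support hc
  simp_rw [← integral_const_mul]
  rw [← integral_finsetSum]
  · congr 1
    ext x
    -- The transpose is needed because `Matrix.det_apply'` permutes row indices, whereas here σ
    -- selects the direction of differentiation.
    rw [← Matrix.det_transpose, Matrix.det_apply', Finset.sum_mul]
    refine Finset.sum_congr rfl fun σ _ => ?_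
    simp only [Matrix.transpose_apply]
    ring
  · intro σ _
    refine Integrable.const_mul (Integrable.bdd_mul (c := B) ?_ hφ.continuous.aestronglyMeasurable
      (Eventually.of_forall hB)) _
    exact (tendsto_integral_mul_prod hn (fun k i => hmeas _ (u.memLp_weakD i (σ i)) k)
      (fun i => u.memLp_weakD i (σ i)) (fun i => hlim _ (u.memLp_weakD i (σ i)))
      hφ.continuous hB).2

/-- The Jacobian of a map in `W^{1,n}` is bounded with respect to the Lipschitz norm of the test
function. -/
theorem exists_abs_integral_det_mul_le (hn : n ≠ 0) :
    ∃ C, ∀ φ : Eucl n → ℝ, ContDiff ℝ ∞ φ → HasCompactSupport φ →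
      ∀ L, (∀ j x, |partialDeriv j φ x| ≤ L) → |∫ x, (u.weakD x).det * φ x| ≤ L * C := by
  let i₀ : Fin n := ⟨0, Nat.pos_of_ne_zero hn⟩
  -- The constant is the total L¹ norm of the flux terms, finite because `u` as well as its
  -- derivatives is in Lⁿ.
  refine ⟨∑ σ : Equiv.Perm (Fin n), ∫ x, ‖∏ i, u.parts i₀ σ i x‖, fun φ hφ hc L hL => ?_⟩
  rw [u.integral_det_mul hn i₀ hφ hc, abs_neg, Finset.mul_sum]
  refine (Finset.abs_sum_le_sum_abs _ _).trans (Finset.sum_le_sum fun σ _ => ?_)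
  have hsign : |((Equiv.Perm.sign σ : ℤ) : ℝ)| = 1 := by
    rcases Int.units_eq_one_or (Equiv.Perm.sign σ) with h | h <;> simp [h]
  rw [abs_mul, hsign, one_mul, ← integral_const_mul]
  have hint : Integrable fun x => ∏ i, u.parts i₀ σ i x := by
    have h := MemLp.prod' (s := Finset.univ) (p := fun _ : Fin n => (n : ℝ≥0∞))
      fun i _ => u.memLp_parts i₀ σ i
    rw [Finset.sum_const, Finset.card_univ, Fintype.card_fin, nsmul_eq_mul,
      ENNReal.mul_inv_cancel (by exact_mod_cast hn) (ENNReal.natCast_ne_top n), inv_one] at h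
    exact memLp_one_iff_integrable.mp h
  rw [← Real.norm_eq_abs]
  refine norm_integral_le_of_norm_le (hint.norm.const_mul L) (Filter.Eventually.of_forall fun x => ?_)
  rw [norm_mul]
  exact mul_le_mul_of_nonneg_right (hL _ _) (norm_nonneg _)

end SobolevMap

/-! ### Dilates and decay of their averages -/

theorem integral_dilate {n : ℕ} (a : Eucl n → ℝ) {s : ℝ} (hs : 0 < s) :
    ∫ x, dilate a s x = ∫ x, a x := by
  unfold dilate
  rw [integral_const_mul, Measure.integral_comp_inv_smul_of_nonneg _ _ hs.le, finrank_euclideanSpace,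
    Fintype.card_fin, smul_eq_mul, inv_mul_cancel_left₀ (pow_pos hs n).ne']

theorem integrable_dilate {n : ℕ} {a : Eucl n → ℝ} (ha : Integrable a) {s : ℝ} (hs : 0 < s) :
    Integrable (dilate a s) :=
  (ha.comp_smul (inv_ne_zero hs.ne')).const_mul _

theorem norm_dilate {n : ℕ} (a : Eucl n → ℝ) {s : ℝ} (hs : 0 < s) (x : Eucl n) :
    ‖dilate a s x‖ = dilate (fun y => ‖a y‖) s x := by
  unfold dilate
  rw [norm_mul, Real.norm_of_nonneg (by positivity)]

theorem norm_dilate_le {n : ℕ} {a : Eucl n → ℝ} {A s : ℝ} (hA : ∀ x, ‖a x‖ ≤ A) (hs : 1 ≤ s)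
    (x : Eucl n) : ‖dilate a s x‖ ≤ A := by
  rw [norm_dilate a (by linarith)]
  have h1 : (s ^ n)⁻¹ ≤ 1 := inv_le_one_of_one_le₀ (one_le_pow₀ hs)
  exact (mul_le_of_le_one_left (norm_nonneg _) h1).trans (hA _)

/-- Rescaling only changes t to t / s, so a bound uniform in t for `a` transfers to all its dilates.
-/
theorem integral_dilate_mul_dilate {n : ℕ} (a η : Eucl n → ℝ) {s : ℝ} (hs : 0 < s) (t : ℝ)
    (x : Eucl n) :
    ∫ y, dilate a s y * dilate η t (x - y) =
      dilate (fun z => ∫ y, a y * dilate η (t / s) (z - y)) s x := by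
  have hsn : (s ^ n) ≠ 0 := (pow_pos hs n).ne'
  have h1 : ∀ y, dilate a s y * dilate η t (x - y) =
      (s ^ n)⁻¹ * ((s ^ n)⁻¹ * (a (s⁻¹ • y) * dilate η (t / s) (s⁻¹ • x - s⁻¹ • y))) := by
    intro y
    have h2 : (t / s)⁻¹ • (s⁻¹ • x - s⁻¹ • y) = t⁻¹ • (x - y) := by
      rw [← smul_sub, smul_smul]
      congr 1
      field_simp
    simp only [dilate, h2, div_pow]
    field_simp
  simp_rw [h1, integral_const_mul]
  rw [Measure.integral_comp_inv_smul_of_nonneg volume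
    (fun y => a y * dilate η (t / s) (s⁻¹ • x - y)) hs.le, finrank_euclideanSpace, Fintype.card_fin,
    smul_eq_mul, inv_mul_cancel_left₀ hsn]
  rfl

theorem one_add_norm_rpow {n : ℕ} (x : Eucl n) :
    (1 + ‖x‖) ^ (-(n + 1 : ℝ)) = ((1 + ‖x‖) ^ (n + 1))⁻¹ := by
  rw [Real.rpow_neg (by positivity)]
  norm_cast

/-- Decay of the averages of a smooth function of mean zero, uniformly in the scale. -/
theorem exists_abs_integral_mul_dilate_le {n : ℕ} {a η : Eucl n → ℝ} (ha : Continuous a)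
    (hac : HasCompactSupport a) (ha0 : ∫ x, a x = 0) (hη : ContDiff ℝ ∞ η)
    (hηc : HasCompactSupport η) :
    ∃ C, 0 ≤ C ∧ ∀ t, 0 < t → ∀ x,
      |∫ y, a y * dilate η t (x - y)| ≤ C * (1 + ‖x‖) ^ (-(n + 1 : ℝ)) := by
  obtain ⟨A, hA⟩ := ha.bounded_above_of_compact_support hac
  obtain ⟨K, hK⟩ := hη.lipschitzWith_of_hasCompactSupport hηc (by simp)
  -- With 1 ≤ R and m = 1 + 2R, one has 1 + ‖x‖ ≤ m when ‖x‖ ≤ 2R, and 1 + ‖x‖ ≤ m‖x‖ beyond.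
  obtain ⟨R, hR1, hR⟩ : ∃ R : ℝ, 1 ≤ R ∧ (R > 0 ∧ ∀ y ∈ tsupport a, ‖y‖ ≤ R) := by
    obtain ⟨R, hR⟩ := hac.isCompact.isBounded.exists_pos_norm_le
    exact ⟨R + 1, by linarith [hR.1], by linarith [hR.1], fun y hy => by linarith [hR.2 y hy]⟩
  obtain ⟨S, hS⟩ := hηc.isCompact.isBounded.exists_pos_norm_le
  have haz : ∀ y, R < ‖y‖ → a y = 0 := fun y hy => by
    by_contra h
    exact absurd (hR.2 y (subset_tsupport _ h)) (not_le.mpr hy)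
  have hηz : ∀ y, S < ‖y‖ → η y = 0 := fun y hy => by
    by_contra h
    exact absurd (hS.2 y (subset_tsupport _ h)) (not_le.mpr hy)
  have haint : Integrable a := ha.integrable_of_hasCompactSupport hac
  have hηint : Integrable η := hη.continuous.integrable_of_hasCompactSupport hηc
  have hA0 : 0 ≤ A := (norm_nonneg _).trans (hA 0)
  set I := ∫ x, ‖η x‖
  have hI : 0 ≤ I := integral_nonneg fun _ => norm_nonneg _
  set J := ∫ x, ‖a x‖
  have hJ : 0 ≤ J := integral_nonneg fun _ => norm_nonneg _
  set m : ℝ := 1 + 2 * R with hm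
  have hm0 : 0 < m := by linarith [hR.1]
  refine ⟨A * I * m ^ (n + 1) + K * R * J * (2 * S * m) ^ (n + 1), ?_, fun t ht x => ?_⟩
  · have := hR.1; have := hS.1
    positivity
  rw [one_add_norm_rpow, ← div_eq_mul_inv, add_div]
  have hx0 : 0 < (1 + ‖x‖) ^ (n + 1) := by positivity
  have hfar0 : 0 ≤ K * R * J * (2 * S * m) ^ (n + 1) / (1 + ‖x‖) ^ (n + 1) := by
    have := hR.1; have := hS.1
    positivity
  have hnear0 : 0 ≤ A * I * m ^ (n + 1) / (1 + ‖x‖) ^ (n + 1) := by positivity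
  rcases le_or_gt ‖x‖ (2 * R) with hx | hx
  · refine le_trans ?_ (le_add_of_nonneg_right hfar0)
    have hbound : |∫ y, a y * dilate η t (x - y)| ≤ A * I := by
      have hI' : ∫ y, ‖dilate η t (x - y)‖ = I := by
        rw [integral_sub_left_eq_self (fun y => ‖dilate η t y‖) volume x]
        simp_rw [norm_dilate η ht]
        exact integral_dilate _ ht
      rw [← hI', ← integral_const_mul, ← Real.norm_eq_abs]
      refine norm_integral_le_of_norm_le
        ((((integrable_dilate hηint ht).comp_sub_left x).norm).const_mul A)
        (Filter.Eventually.of_forall fun y => ?_)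
      rw [norm_mul]
      exact mul_le_mul_of_nonneg_right (hA y) (norm_nonneg _)
    rw [le_div_iff₀ hx0]
    exact mul_le_mul hbound (pow_le_pow_left₀ (by positivity) (by linarith) _) hx0.le (by positivity)
  · refine le_trans ?_ (le_add_of_nonneg_left hnear0)
    -- Far from the support of `a`, a small t gives disjoint supports, since ‖x - y‖ ≥ ‖x‖/2 > St;
    -- otherwise t is at least of order ‖x‖.
    rcases lt_or_ge (2 * S * t) ‖x‖ with htx | htx
    · have hzero : ∀ y, a y * dilate η t (x - y) = 0 := by
        intro y
        rcases lt_or_ge R ‖y‖ with hy | hy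
        · rw [haz y hy, zero_mul]
        · have h1 : ‖x‖ ≤ ‖x - y‖ + ‖y‖ := norm_le_norm_sub_add x y
          have h2 : S < ‖t⁻¹ • (x - y)‖ := by
            rw [norm_smul, Real.norm_of_nonneg (by positivity), inv_mul_eq_div, lt_div_iff₀ ht]
            linarith
          rw [dilate, hηz _ h2, mul_zero, mul_zero]
      simp only [hzero, integral_zero, abs_zero]
      exact hfar0
    · have hint : Integrable fun y => a y * dilate η t (x - y) :=
        (ha.mul (dilate_contDiff hη t x).continuous).integrable_of_hasCompactSupport hac.mul_right
      -- Mean zero allows the subtraction of the kernel at x; its Lipschitz bound gains the factor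
      -- t⁻¹ that makes the decay integrable.
      have h1 : ∫ y, a y * dilate η t (x - y) =
          ∫ y, a y * (dilate η t (x - y) - dilate η t x) := by
        simp_rw [mul_sub]
        rw [integral_sub hint (haint.mul_const _), integral_mul_const, ha0, zero_mul, sub_zero]
      have h2 : ∀ y, ‖a y * (dilate η t (x - y) - dilate η t x)‖ ≤
          ‖a y‖ * (K * R * (t ^ (n + 1))⁻¹) := by
        intro y
        rw [norm_mul]
        rcases lt_or_ge R ‖y‖ with hy | hy
        · simp [haz y hy]
        · refine mul_le_mul_of_nonneg_left ?_ (norm_nonneg _)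
          have h3 := hK.dist_le_mul (t⁻¹ • (x - y)) (t⁻¹ • x)
          rw [dist_eq_norm, dist_eq_norm, ← smul_sub, norm_smul, sub_sub_cancel_left, norm_neg,
            Real.norm_of_nonneg (inv_nonneg.mpr ht.le)] at h3
          rw [dilate, dilate, ← mul_sub, norm_mul, Real.norm_of_nonneg (by positivity)]
          calc (t ^ n)⁻¹ * ‖η (t⁻¹ • (x - y)) - η (t⁻¹ • x)‖
              ≤ (t ^ n)⁻¹ * (K * (t⁻¹ * R)) := by
                refine mul_le_mul_of_nonneg_left (h3.trans ?_) (by positivity)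
                gcongr
            _ = K * R * (t ^ (n + 1))⁻¹ := by rw [pow_succ, mul_inv]; ring
      have h3 : |∫ y, a y * dilate η t (x - y)| ≤ J * (K * R * (t ^ (n + 1))⁻¹) := by
        rw [h1, ← integral_mul_const, ← Real.norm_eq_abs]
        exact norm_integral_le_of_norm_le (haint.norm.mul_const _) (Filter.Eventually.of_forall h2)
      have h4 : (t ^ (n + 1))⁻¹ ≤ (2 * S * m) ^ (n + 1) / (1 + ‖x‖) ^ (n + 1) := by
        rw [← div_pow, ← inv_pow]
        refine pow_le_pow_left₀ (by positivity) ?_ _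
        rw [inv_eq_one_div, div_le_div_iff₀ ht (by positivity), one_mul]
        calc 1 + ‖x‖ ≤ m * ‖x‖ := by nlinarith
          _ ≤ m * (2 * S * t) := mul_le_mul_of_nonneg_left htx hm0.le
          _ = 2 * S * m * t := by ring
      refine h3.trans ?_
      have := hR.1
      calc J * (K * R * (t ^ (n + 1))⁻¹)
          ≤ J * (K * R * ((2 * S * m) ^ (n + 1) / (1 + ‖x‖) ^ (n + 1))) := by gcongr
        _ = _ := by ring

/-! ### A Hardy space element with mass at all large scales -/

/-- The superposition `∑ₖ 2⁻ᵏ a_{4ᵏ}` of dilates of `a`. -/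
def dilateSum {n : ℕ} (a : Eucl n → ℝ) (x : Eucl n) : ℝ :=
  ∑' k : ℕ, (1 / 2 : ℝ) ^ k * dilate a (4 ^ k) x

theorem continuous_dilateSum {n : ℕ} {a : Eucl n → ℝ} (ha : Continuous a)
    (hac : HasCompactSupport a) : Continuous (dilateSum a) := by
  obtain ⟨A, hA⟩ := ha.bounded_above_of_compact_support hac
  refine continuous_tsum (fun k => ?_) (summable_geometric_two.mul_right A) fun k x => ?_
  · unfold dilate
    fun_prop
  · rw [norm_mul, Real.norm_of_nonneg (by positivity)]
    exact mul_le_mul_of_nonneg_left (norm_dilate_le hA (one_le_pow₀ (by norm_num)) x)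
      (by positivity)

theorem integrable_dilateSum {n : ℕ} {a : Eucl n → ℝ} (ha : Continuous a)
    (hac : HasCompactSupport a) : Integrable (dilateSum a) := by
  have haint : Integrable a := ha.integrable_of_hasCompactSupport hac
  refine ⟨(continuous_dilateSum ha hac).aestronglyMeasurable, ?_⟩
  have hle : ∀ x, ‖dilateSum a x‖ₑ ≤
      ∑' k : ℕ, ENNReal.ofReal ((1 / 2 : ℝ) ^ k * dilate (fun y => ‖a y‖) (4 ^ k) x) := by
    intro x
    refine enorm_tsum_le_tsum_enorm.trans (ENNReal.tsum_le_tsum fun k => ?_)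
    rw [← norm_dilate a (by positivity), ← ofReal_norm, norm_mul,
      Real.norm_of_nonneg (by positivity : (0 : ℝ) ≤ (1 / 2) ^ k)]
  refine (lintegral_mono hle).trans_lt ?_
  have hk : ∀ k : ℕ, Integrable fun x => (1 / 2 : ℝ) ^ k * dilate (fun y => ‖a y‖) (4 ^ k) x :=
    fun k => (integrable_dilate haint.norm (by positivity)).const_mul _
  rw [lintegral_tsum fun k => (hk k).aestronglyMeasurable.aemeasurable.ennreal_ofReal]
  have hval : ∀ k : ℕ, ∫⁻ x, ENNReal.ofReal ((1 / 2 : ℝ) ^ k * dilate (fun y => ‖a y‖) (4 ^ k) x) =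
      ENNReal.ofReal ((1 / 2 : ℝ) ^ k * ∫ x, ‖a x‖) := by
    intro k
    rw [← ofReal_integral_eq_lintegral_ofReal (hk k) (Filter.Eventually.of_forall fun x => ?_),
      integral_const_mul, integral_dilate _ (by positivity)]
    simp only [dilate, Pi.zero_apply]
    positivity
  simp_rw [hval]
  exact (summable_geometric_two.mul_right _).tsum_ofReal_lt_top

theorem hasSum_integral_dilateSum_mul {n : ℕ} {a : Eucl n → ℝ} (ha : Continuous a)
    (hac : HasCompactSupport a) {g : Eucl n → ℝ} (hg : Continuous g) {B : ℝ}
    (hB : ∀ x, ‖g x‖ ≤ B) :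
    HasSum (fun k : ℕ => (1 / 2 : ℝ) ^ k * ∫ x, dilate a (4 ^ k) x * g x)
      (∫ x, dilateSum a x * g x) := by
  have haint : Integrable a := ha.integrable_of_hasCompactSupport hac
  have hd : ∀ k : ℕ, Integrable (dilate a (4 ^ k)) := fun k => integrable_dilate haint (by positivity)
  have hint : ∀ k : ℕ, Integrable fun x => (1 / 2 : ℝ) ^ k * (dilate a (4 ^ k) x * g x) := fun k =>
    ((hd k).mul_bdd hg.aestronglyMeasurable (Filter.Eventually.of_forall hB)).const_mul _
  have hsum : Summable fun k : ℕ => ∫ x, ‖(1 / 2 : ℝ) ^ k * (dilate a (4 ^ k) x * g x)‖ := by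
    refine Summable.of_nonneg_of_le (fun k => integral_nonneg fun _ => norm_nonneg _) (fun k => ?_)
      (summable_geometric_two.mul_right ((∫ x, ‖a x‖) * B))
    calc ∫ x, ‖(1 / 2 : ℝ) ^ k * (dilate a (4 ^ k) x * g x)‖
        ≤ ∫ x, (1 / 2 : ℝ) ^ k * (‖dilate a (4 ^ k) x‖ * B) := by
          refine integral_mono (hint k).norm (((hd k).norm.mul_const B).const_mul _) fun x => ?_
          simp only [norm_mul, Real.norm_of_nonneg (by positivity : (0 : ℝ) ≤ (1 / 2) ^ k)]
          exact mul_le_mul_of_nonneg_left (mul_le_mul_of_nonneg_left (hB x) (norm_nonneg _))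
            (by positivity)
      _ = (1 / 2 : ℝ) ^ k * ((∫ x, ‖a x‖) * B) := by
          rw [integral_const_mul, integral_mul_const]
          simp_rw [norm_dilate a (by positivity : (0 : ℝ) < 4 ^ k)]
          rw [integral_dilate _ (by positivity)]
  have h := hasSum_integral_of_summable_integral_norm hint hsum
  simp_rw [integral_const_mul] at h
  have hfun : (fun x => dilateSum a x * g x) =
      fun x => ∑' k : ℕ, (1 / 2 : ℝ) ^ k * (dilate a (4 ^ k) x * g x) := by
    ext x
    simp_rw [dilateSum, ← tsum_mul_right, mul_assoc]
  rwa [hfun]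

/-- The maximal function of the k-th summand is dominated by 2⁻ᵏ times the L¹-normalised dilate of
one integrable majorant `G`, so the integrals sum geometrically. -/
theorem ofIntegrable_dilateSum_mem_hardyH1 {n : ℕ} {a : Eucl n → ℝ} (ha : Continuous a)
    (hac : HasCompactSupport a) (ha0 : ∫ x, a x = 0) {η : Eucl n → ℝ}
    (hs : ContDiff ℝ ∞ η) (hc : HasCompactSupport η) :
    ofIntegrable (dilateSum a) (integrable_dilateSum ha hac) ∈ hardyH1 hs hc := by
  obtain ⟨C, hC0, hC⟩ := exists_abs_integral_mul_dilate_le ha hac ha0 hs hc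
  set G : Eucl n → ℝ := fun x => C * (1 + ‖x‖) ^ (-(n + 1 : ℝ)) with hG
  have hG0 : ∀ x, 0 ≤ G x := fun x => by positivity
  have hGint : Integrable G :=
    (integrable_one_add_norm (by simp [finrank_euclideanSpace])).const_mul C
  have hGk : ∀ k : ℕ, Integrable fun x => (1 / 2 : ℝ) ^ k * dilate G (4 ^ k) x := fun k =>
    (integrable_dilate hGint (by positivity)).const_mul _
  have hpt : ∀ x, (⨆ (t : ℝ) (ht : 0 < t),
      ‖convDilate (ofIntegrable (dilateSum a) (integrable_dilateSum ha hac)) hs hc ht x‖ₑ) ≤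
      ∑' k : ℕ, ENNReal.ofReal ((1 / 2 : ℝ) ^ k * dilate G (4 ^ k) x) := by
    intro x
    refine iSup₂_le fun t ht => ?_
    have hcont := (dilate_contDiff hs t x).continuous
    obtain ⟨B, hB⟩ := hcont.bounded_above_of_compact_support (dilate_hasCompactSupport hc ht x)
    have hval : convDilate (ofIntegrable (dilateSum a) (integrable_dilateSum ha hac)) hs hc ht x =
        ∑' k : ℕ, (1 / 2 : ℝ) ^ k * ∫ y, dilate a (4 ^ k) y * dilate η t (x - y) :=
      (hasSum_integral_dilateSum_mul ha hac hcont hB).tsum_eq.symm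
    rw [hval]
    refine enorm_tsum_le_tsum_enorm.trans (ENNReal.tsum_le_tsum fun k => ?_)
    rw [← ofReal_norm, norm_mul, Real.norm_of_nonneg (by positivity : (0 : ℝ) ≤ (1 / 2) ^ k),
      integral_dilate_mul_dilate _ _ (by positivity), norm_dilate _ (by positivity)]
    refine ENNReal.ofReal_le_ofReal (mul_le_mul_of_nonneg_left ?_ (by positivity))
    exact mul_le_mul_of_nonneg_left (hC _ (by positivity) _) (by positivity)
  refine (lintegral_mono hpt).trans_lt ?_
  rw [lintegral_tsum fun k => (hGk k).aestronglyMeasurable.aemeasurable.ennreal_ofReal]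
  have hval : ∀ k : ℕ, ∫⁻ x, ENNReal.ofReal ((1 / 2 : ℝ) ^ k * dilate G (4 ^ k) x) =
      ENNReal.ofReal ((1 / 2 : ℝ) ^ k * ∫ x, G x) := by
    intro k
    rw [← ofReal_integral_eq_lintegral_ofReal (hGk k) (Filter.Eventually.of_forall fun x => ?_),
      integral_const_mul, integral_dilate _ (by positivity)]
    exact mul_nonneg (by positivity) (mul_nonneg (by positivity) (hG0 _))
  simp_rw [hval]
  exact (summable_geometric_two.mul_right _).tsum_ofReal_lt_top

/-! ### The odd bump and the test functions -/

/-- The compactly supported function `xᵢ χ(x)`, odd because the cut-off `χ` is even. -/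
def coordBump {n : ℕ} (i : Fin n) (x : Eucl n) : ℝ :=
  x i * (⟨1, 2, one_pos, one_lt_two⟩ : ContDiffBump (0 : Eucl n)) x

theorem contDiff_coordBump {n : ℕ} (i : Fin n) : ContDiff ℝ ∞ (coordBump i) :=
  (EuclideanSpace.proj (𝕜 := ℝ) i).contDiff.mul (ContDiffBump.contDiff _)

theorem hasCompactSupport_coordBump {n : ℕ} (i : Fin n) : HasCompactSupport (coordBump i) :=
  (ContDiffBump.hasCompactSupport _).mul_left

theorem integral_coordBump {n : ℕ} (i : Fin n) : ∫ x, coordBump i x = 0 := by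
  have h := integral_neg_eq_self (coordBump i) (volume : Measure (Eucl n))
  have h1 : ∀ x, coordBump i (-x) = -coordBump i x := fun x => by
    simp [coordBump, ContDiffBump.neg]
  simp_rw [h1, integral_neg] at h
  linarith

/-- Both factors carry the sign of xᵢ. This rules out cancellation between different scales in the
pairing with the superposition. -/
theorem dilate_coordBump_mul_nonneg {n : ℕ} (i : Fin n) {s r : ℝ} (hs : 0 < s) (hr : 0 < r)
    (x : Eucl n) : 0 ≤ dilate (coordBump i) s x * coordBump i (r⁻¹ • x) := by
  have h : dilate (coordBump i) s x * coordBump i (r⁻¹ • x) =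
      (s ^ n)⁻¹ * s⁻¹ * r⁻¹ * (x i * x i) *
        ((⟨1, 2, one_pos, one_lt_two⟩ : ContDiffBump (0 : Eucl n)) (s⁻¹ • x) *
          (⟨1, 2, one_pos, one_lt_two⟩ : ContDiffBump (0 : Eucl n)) (r⁻¹ • x)) := by
    simp only [dilate, coordBump, PiLp.smul_apply, smul_eq_mul]
    ring
  rw [h]
  exact mul_nonneg (mul_nonneg (by positivity) (mul_self_nonneg _))
    (mul_nonneg (ContDiffBump.nonneg _) (ContDiffBump.nonneg _))

theorem integral_coordBump_sq_pos {n : ℕ} (i : Fin n) :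
    0 < ∫ x, coordBump i x * coordBump i x := by
  have hcont := (contDiff_coordBump i).continuous
  refine Continuous.integral_pos_of_hasCompactSupport_nonneg_nonzero (x := EuclideanSpace.single i 1)
    (hcont.mul hcont) (hasCompactSupport_coordBump i).mul_left (fun x => mul_self_nonneg _) ?_
  have h1 : (⟨1, 2, one_pos, one_lt_two⟩ : ContDiffBump (0 : Eucl n))
      (EuclideanSpace.single i 1) = 1 := ContDiffBump.one_of_mem_closedBall _ (by simp)
  simp [coordBump, h1]

/-- The superposition of the dilates of `coordBump i` is unbounded on test functions with bounded
gradient. -/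
theorem le_integral_dilateSum_coordBump_mul {n : ℕ} (i : Fin n) (m : ℕ) :
    2 ^ m * ∫ x, coordBump i x * coordBump i x ≤
      ∫ x, dilateSum (coordBump i) x * (4 ^ m * coordBump i (((4 : ℝ) ^ m)⁻¹ • x)) := by
  have hcont := (contDiff_coordBump i).continuous
  have h4 : (0 : ℝ) < 4 ^ m := by positivity
  obtain ⟨B, hB⟩ := hcont.bounded_above_of_compact_support (hasCompactSupport_coordBump i)
  have hsum := hasSum_integral_dilateSum_mul hcont (hasCompactSupport_coordBump i)
    (g := fun x => 4 ^ m * coordBump i (((4 : ℝ) ^ m)⁻¹ • x)) (by fun_prop) (B := 4 ^ m * B)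
    (fun x => by
      rw [norm_mul, Real.norm_of_nonneg h4.le]
      exact mul_le_mul_of_nonneg_left (hB _) h4.le)
  -- All terms are nonnegative, so the m-th alone is a lower bound: its weight 2⁻ᵐ times the
  -- amplitude 4ᵐ gives 2ᵐ.
  refine le_trans (le_of_eq ?_) (le_hasSum hsum m fun k _ => ?_)
  · have h1 : ∀ x, dilate (coordBump i) (4 ^ m) x * (4 ^ m * coordBump i (((4 : ℝ) ^ m)⁻¹ • x)) =
        4 ^ m * dilate (fun x => coordBump i x * coordBump i x) (4 ^ m) x := fun x => by
      simp only [dilate]; ring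
    simp_rw [h1]
    rw [integral_const_mul, integral_dilate _ h4, ← mul_assoc, ← mul_pow]
    norm_num
  · refine mul_nonneg (by positivity) (integral_nonneg fun x => ?_)
    have := dilate_coordBump_mul_nonneg i (s := 4 ^ k) (r := 4 ^ m) (by positivity) h4 x
    simp only [Pi.zero_apply]
    rw [mul_left_comm]
    exact mul_nonneg h4.le this

theorem partialDeriv_rescale {n : ℕ} (j : Fin n) {f : Eucl n → ℝ} (hf : ContDiff ℝ ∞ f) {r : ℝ}
    (hr : r ≠ 0) (x : Eucl n) :
    partialDeriv j (fun y => r * f (r⁻¹ • y)) x = partialDeriv j f (r⁻¹ • x) := by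
  have h1 := ((hf.differentiable (by simp) (r⁻¹ • x)).hasFDerivAt.comp x
    ((hasFDerivAt_id x).const_smul r⁻¹)).const_mul r
  have h2 : fderiv ℝ (fun y => r * f (r⁻¹ • y)) x = _ := h1.fderiv
  rw [partialDeriv, h2, partialDeriv]
  simp [hr]

end
-- Contradiction between the two estimates
/-- For every `n ≥ 2` the Jacobian operator does not map `W^{1,n}(ℝⁿ, ℝⁿ)` onto `ℋ¹(ℝⁿ)`,
whichever test function `η` with nonzero integral is used to define `ℋ¹(ℝⁿ)`. -/
theorem corollary1p3 (n : ℕ) (hn : 2 ≤ n) (η : Eucl n → ℝ) (hs : ContDiff ℝ ∞ η)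
    (hc : HasCompactSupport η) (hη : (∫ x, η x) ≠ 0) :
    ¬ (hardyH1 hs hc ⊆ Set.range (jacobian : SobolevMap n → RealTempered n)) := by
  intro hsub
  let i : Fin n := ⟨0, by omega⟩
  have hsm := contDiff_coordBump i
  have hcs := hasCompactSupport_coordBump i
  obtain ⟨u, hu⟩ := hsub
    (ofIntegrable_dilateSum_mem_hardyH1 hsm.continuous hcs (integral_coordBump i) hs hc)
  obtain ⟨C, hC⟩ := u.exists_abs_integral_det_mul_le (by omega)
  -- One `L` serves every m, since x ↦ r f(x / r) has the same gradient bound as f.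
  obtain ⟨L, hL⟩ : ∃ L, ∀ j x, |partialDeriv j (coordBump i) x| ≤ L := by
    choose B hB using fun j => (contDiff_partialDeriv j hsm).continuous.bounded_above_of_compact_support
      (hasCompactSupport_partialDeriv j hcs)
    obtain ⟨L, hL⟩ := Finite.bddAbove_range B
    exact ⟨L, fun j x => (hB j x).trans (hL ⟨j, rfl⟩)⟩
  have hbound : ∀ m : ℕ, 2 ^ m * ∫ x, coordBump i x * coordBump i x ≤ L * C := by
    intro m
    have h4 : (4 : ℝ) ^ m ≠ 0 := by positivity
    have hφs : ContDiff ℝ ∞ fun x => 4 ^ m * coordBump i (((4 : ℝ) ^ m)⁻¹ • x) := by fun_prop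
    have hφc : HasCompactSupport fun x => 4 ^ m * coordBump i (((4 : ℝ) ^ m)⁻¹ • x) :=
      (hcs.comp_smul (inv_ne_zero h4)).mul_left
    refine (le_integral_dilateSum_coordBump_mul i m).trans ?_
    have h1 := congrArg (fun T => T (hφc.toSchwartzMap hφs)) hu
    have h2 : ∫ x, (u.weakD x).det * (4 ^ m * coordBump i (((4 : ℝ) ^ m)⁻¹ • x)) =
      ∫ x, dilateSum (coordBump i) x * (4 ^ m * coordBump i (((4 : ℝ) ^ m)⁻¹ • x)) := h1
    rw [← h2]
    refine (le_abs_self _).trans (hC _ hφs hφc L fun j x => ?_)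
    rw [partialDeriv_rescale j hsm h4]
    exact hL _ _
  have hlim := (tendsto_pow_atTop_atTop_of_one_lt (one_lt_two (α := ℝ))).atTop_mul_const
    (integral_coordBump_sq_pos i)
  obtain ⟨m, hm⟩ := (hlim.eventually_gt_atTop (L * C)).exists
  exact absurd (hbound m) (not_le.mpr hm)
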